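/- Let $(M,g)$ be a smooth Riemannian manifold of dimension $n\ge 3$ with Ricci tensor $\mathrm{Ric}$, scalar curvature $R$ and Levi-Civita connection $\nabla$. Let $\alpha,\beta,\lambda\in\mathbb{R}$ with $\alpha\neq 0$, and let $X$ be a smooth vector field such that $(M,g)$ is a Ricci–Yamabe soliton with potential field $X$, i.e. $$\alpha\,\mathrm{Ric}+\tfrac12\mathcal{L}_Xg+\Bigl(\lambda-\tfrac{\beta}{2}R\Bigr)g=0 .$$ The soliton is called expanding, steady or shrinking if $\lambda>0$, $\lambda=0$ or $\lambda<0$, respectively. Suppose that $X$ is concircular, i.e. there is a smooth function $\phi$ on $M$ with $\nabla_YX=\phi Y$ for every vector field $Y$. Then, at every point $p\in M$: the soliton is expanding if and only if $\phi(p)<\frac{n\beta-2\alpha}{2n}R(p)$, steady if and only if $\phi(p)=\frac{n\beta-2\alpha}{2n}R(p)$, and shrinking if and only if $\phi(p)>\frac{n\beta-2\alpha}{2n}R(p)$. -/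

import Mathlib

open Bundle FiberBundle VectorField NormedSpace
open scoped Manifold ContDiff

noncomputable section

namespace RicciYamabe

variable {n : ℕ} {M : Type*} [TopologicalSpace M] [ChartedSpace (EuclideanSpace ℝ (Fin n)) M]
  [IsManifold (𝓡 n) ∞ M]
  [RiemannianBundle (fun x : M => TangentSpace (𝓡 n) x)]

/-- Differentiability of a vector field at a point. -/
abbrev DiffAt (X : Π x : M, TangentSpace (𝓡 n) x) (p : M) : Prop :=
  MDifferentiableAt (𝓡 n) (𝓡 n).tangent
    (fun x => TotalSpace.mk' (EuclideanSpace ℝ (Fin n)) x (X x)) p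

/-- The function `x ↦ g(Y, Z)(x)`. -/
def metricFun (Y Z : Π x : M, TangentSpace (𝓡 n) x) (x : M) : ℝ := inner ℝ (Y x) (Z x)

/-- The Koszul expression
`Y g(X, Z) + X g(Y, Z) - Z g(Y, X) + g([Y, X], Z) - g([Y, Z], X) - g([X, Z], Y)` at `p`,
which is `2 g(∇_Y X, Z)` at `p` for the Levi-Civita connection `∇`. -/
def koszul (X Y Z : Π x : M, TangentSpace (𝓡 n) x) (p : M) : ℝ :=
  mvfderiv (𝓡 n) (metricFun X Z) p (Y p) + mvfderiv (𝓡 n) (metricFun Y Z) p (X p)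
    - mvfderiv (𝓡 n) (metricFun Y X) p (Z p)
    + inner ℝ (mlieBracket (𝓡 n) Y X p) (Z p)
    - inner ℝ (mlieBracket (𝓡 n) Y Z p) (X p)
    - inner ℝ (mlieBracket (𝓡 n) X Z p) (Y p)

theorem nabla_ext {p : M} {A B : TangentSpace (𝓡 n) p →L[ℝ] TangentSpace (𝓡 n) p}
    (h : ∀ Y Z : Π x : M, TangentSpace (𝓡 n) x, DiffAt Y p → DiffAt Z p →
      2 * inner ℝ (A (Y p)) (Z p) = 2 * inner ℝ (B (Y p)) (Z p)) : A = B := by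
  ext1 v
  refine ext_inner_right ℝ fun w => ?_
  have := h (extend (EuclideanSpace ℝ (Fin n)) v) (extend (EuclideanSpace ℝ (Fin n)) w)
    (mdifferentiableAt_extend (I := 𝓡 n) ..) (mdifferentiableAt_extend (I := 𝓡 n) ..)
  simpa using this

section Smooth

variable [IsContMDiffRiemannianBundle (𝓡 n) ∞ (EuclideanSpace ℝ (Fin n))
    (fun x : M => TangentSpace (𝓡 n) x)]

theorem mdiff_metricFun {Y Z : Π x : M, TangentSpace (𝓡 n) x} {p : M}
    (hY : DiffAt Y p) (hZ : DiffAt Z p) :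
    MDifferentiableAt (𝓡 n) 𝓘(ℝ, ℝ) (metricFun Y Z) p :=
  haveI : IsContMDiffRiemannianBundle (𝓡 n) 1 (EuclideanSpace ℝ (Fin n))
    (fun x : M => TangentSpace (𝓡 n) x) := IsContMDiffRiemannianBundle.of_le (n := ∞) (by simp)
  MDifferentiableAt.inner_bundle (IB := 𝓡 n) (F := EuclideanSpace ℝ (Fin n)) hY hZ

theorem koszul_tensorial_right {X Y : Π x : M, TangentSpace (𝓡 n) x} {p : M}
    (hX : DiffAt X p) (hY : DiffAt Y p) :
    TensorialAt (𝓡 n) (EuclideanSpace ℝ (Fin n)) (fun Z => koszul X Y Z p) p where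
  smul {f Z} hf hZ := by
    have e1 : metricFun X (f • Z) = f * metricFun X Z := by
      ext x; simp [metricFun, inner_smul_right]
    have e2 : metricFun Y (f • Z) = f * metricFun Y Z := by
      ext x; simp [metricFun, inner_smul_right]
    simp only [koszul, e1, e2, mvfderiv_mul hf (mdiff_metricFun hX hZ),
      mvfderiv_mul hf (mdiff_metricFun hY hZ), mlieBracket_smul_right hf hZ]
    simp [metricFun, inner_add_left, inner_smul_left, inner_smul_right, real_inner_comm (Z p)]
    ring
  add {Z Z'} hZ hZ' := by
    have e1 : metricFun X (Z + Z') = metricFun X Z + metricFun X Z' := by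
      ext x; simp [metricFun, inner_add_right]
    have e2 : metricFun Y (Z + Z') = metricFun Y Z + metricFun Y Z' := by
      ext x; simp [metricFun, inner_add_right]
    simp only [koszul, e1, e2, mvfderiv_add (mdiff_metricFun hX hZ) (mdiff_metricFun hX hZ'),
      mvfderiv_add (mdiff_metricFun hY hZ) (mdiff_metricFun hY hZ'), mlieBracket_add_right hZ hZ']
    simp [inner_add_left, inner_add_right]
    ring

theorem koszul_tensorial_left {X Z : Π x : M, TangentSpace (𝓡 n) x} {p : M}
    (hX : DiffAt X p) (hZ : DiffAt Z p) :
    TensorialAt (𝓡 n) (EuclideanSpace ℝ (Fin n)) (fun Y => koszul X Y Z p) p where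
  smul {f Y} hf hY := by
    have e1 : metricFun (f • Y) X = f * metricFun Y X := by
      ext x; simp [metricFun, inner_smul_left]
    have e2 : metricFun (f • Y) Z = f * metricFun Y Z := by
      ext x; simp [metricFun, inner_smul_left]
    simp only [koszul, e1, e2, mvfderiv_mul hf (mdiff_metricFun hY hX),
      mvfderiv_mul hf (mdiff_metricFun hY hZ), mlieBracket_smul_left hf hY]
    simp [metricFun, inner_add_left, inner_smul_left, inner_smul_right]
    ring
  add {Y Y'} hY hY' := by
    have e1 : metricFun (Y + Y') X = metricFun Y X + metricFun Y' X := by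
      ext x; simp [metricFun, inner_add_left]
    have e2 : metricFun (Y + Y') Z = metricFun Y Z + metricFun Y' Z := by
      ext x; simp [metricFun, inner_add_left]
    simp only [koszul, e1, e2, mvfderiv_add (mdiff_metricFun hY hX) (mdiff_metricFun hY' hX),
      mvfderiv_add (mdiff_metricFun hY hZ) (mdiff_metricFun hY' hZ), mlieBracket_add_left hY hY']
    simp [inner_add_left, inner_add_right]
    ring

theorem koszul_smul {X Y Z : Π x : M, TangentSpace (𝓡 n) x} {f : M → ℝ} {p : M}
    (hf : MDifferentiableAt (𝓡 n) 𝓘(ℝ, ℝ) f p) (hX : DiffAt X p) (hY : DiffAt Y p) (hZ : DiffAt Z p) :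
    koszul (f • X) Y Z p
      = f p * koszul X Y Z p + 2 * (mvfderiv (𝓡 n) f p (Y p) * inner ℝ (X p) (Z p)) := by
  have e1 : metricFun (f • X) Z = f * metricFun X Z := by
    ext x; simp [metricFun, inner_smul_left]
  have e2 : metricFun Y (f • X) = f * metricFun Y X := by
    ext x; simp [metricFun, inner_smul_right]
  simp only [koszul, e1, e2, mvfderiv_mul hf (mdiff_metricFun hX hZ),
    mvfderiv_mul hf (mdiff_metricFun hY hX), mlieBracket_smul_left hf hX,
    mlieBracket_smul_right hf hX]
  simp [metricFun, inner_add_left, inner_smul_left, inner_smul_right, real_inner_comm (X p)]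
  ring

theorem koszul_add {X X' Y Z : Π x : M, TangentSpace (𝓡 n) x} {p : M}
    (hX : DiffAt X p) (hX' : DiffAt X' p) (hY : DiffAt Y p)
    (hZ : DiffAt Z p) :
    koszul (X + X') Y Z p = koszul X Y Z p + koszul X' Y Z p := by
  have e1 : metricFun (X + X') Z = metricFun X Z + metricFun X' Z := by
    ext x; simp [metricFun, inner_add_left]
  have e2 : metricFun Y (X + X') = metricFun Y X + metricFun Y X' := by
    ext x; simp [metricFun, inner_add_right]
  simp only [koszul, e1, e2, mvfderiv_add (mdiff_metricFun hX hZ) (mdiff_metricFun hX' hZ),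
    mvfderiv_add (mdiff_metricFun hY hX) (mdiff_metricFun hY hX'), mlieBracket_add_left hX hX',
    mlieBracket_add_right hX hX']
  simp [inner_add_left, inner_add_right]
  ring

/-- For `X` differentiable at `p`: the bilinear form `(Y, Z) ↦ 2 g(∇_Y X, Z)` on `T_p M`. -/
def koszulForm (X : Π x : M, TangentSpace (𝓡 n) x) (p : M) (hX : DiffAt X p) :
    TangentSpace (𝓡 n) p →L[ℝ] TangentSpace (𝓡 n) p →L[ℝ] ℝ :=
  TensorialAt.mkHom₂ (I := 𝓡 n) (F := EuclideanSpace ℝ (Fin n)) (F' := EuclideanSpace ℝ (Fin n))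
    (V := fun x : M => TangentSpace (𝓡 n) x) (V' := fun x : M => TangentSpace (𝓡 n) x)
    (fun Y Z => koszul X Y Z p) p
    (fun _ hZ => koszul_tensorial_left hX hZ) (fun _ hY => koszul_tensorial_right hX hY)

/-- `koszulForm` applied to the values at `p` of vector fields. -/
theorem koszulForm_apply {X Y Z : Π x : M, TangentSpace (𝓡 n) x} {p : M} (hX : DiffAt X p)
    (hY : DiffAt Y p) (hZ : DiffAt Z p) :
    koszulForm X p hX (Y p) (Z p) = koszul X Y Z p :=
  TensorialAt.mkHom₂_apply _ _ hY hZ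

/-- The Levi-Civita derivative `v ↦ ∇_v X` at `p` of a vector field `X` that is differentiable at
`p`: the solution of `2 g(∇_v X, w) = koszulForm X p v w` for all `w`. -/
def nablaAt (X : Π x : M, TangentSpace (𝓡 n) x) (p : M) (hX : DiffAt X p) :
    TangentSpace (𝓡 n) p →L[ℝ] TangentSpace (𝓡 n) p :=
  haveI : FiniteDimensional ℝ (TangentSpace (𝓡 n) p) :=
    inferInstanceAs (FiniteDimensional ℝ (EuclideanSpace ℝ (Fin n)))
  haveI : CompleteSpace (TangentSpace (𝓡 n) p) := FiniteDimensional.complete ℝ _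
  LinearMap.toContinuousLinearMap
    { toFun := fun v => (1 / 2 : ℝ) •
        (InnerProductSpace.toDual ℝ (TangentSpace (𝓡 n) p)).symm (koszulForm X p hX v)
      map_add' := fun v w => by simp
      map_smul' := fun c v => by simp [smul_smul, mul_comm] }

theorem inner_nablaAt {X : Π x : M, TangentSpace (𝓡 n) x} {p : M} (hX : DiffAt X p)
    (v w : TangentSpace (𝓡 n) p) :
    2 * inner ℝ (nablaAt X p hX v) w = koszulForm X p hX v w := by
  have : FiniteDimensional ℝ (TangentSpace (𝓡 n) p) :=
    inferInstanceAs (FiniteDimensional ℝ (EuclideanSpace ℝ (Fin n)))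
  have : CompleteSpace (TangentSpace (𝓡 n) p) := FiniteDimensional.complete ℝ _
  simp [nablaAt, inner_smul_left]

open Classical in
/-- `∇ X`, extended by zero to the points where `X` is not differentiable. -/
def nabla (X : Π x : M, TangentSpace (𝓡 n) x) (p : M) :
    TangentSpace (𝓡 n) p →L[ℝ] TangentSpace (𝓡 n) p :=
  if hX : DiffAt X p then nablaAt X p hX else 0

theorem inner_nabla {X Y Z : Π x : M, TangentSpace (𝓡 n) x} {p : M} (hX : DiffAt X p)
    (hY : DiffAt Y p) (hZ : DiffAt Z p) :
    2 * inner ℝ (nabla X p (Y p)) (Z p) = koszul X Y Z p := by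
  rw [nabla, dif_pos hX, inner_nablaAt, koszulForm_apply hX hY hZ]

variable (n M) in
/-- The Levi-Civita connection of `(M, g)`; `leviCivita n M X p v` is `∇_v X` at `p`. -/
def leviCivita : CovariantDerivative (𝓡 n) (EuclideanSpace ℝ (Fin n))
    (fun x : M => TangentSpace (𝓡 n) x) where
  toFun := nabla
  isCovariantDerivativeOnUniv :=
    { add := fun {X X' p} hX hX' _ => nabla_ext fun Y Z hY hZ => by
        have hXX' : DiffAt (X + X') p := mdifferentiableAt_add_section hX hX'
        rw [inner_nabla hXX' hY hZ, koszul_add hX hX' hY hZ, ← inner_nabla hX hY hZ,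
          ← inner_nabla hX' hY hZ, add_apply, inner_add_left]
        ring
      leibniz := fun {X f p} hX hf _ => nabla_ext fun Y Z hY hZ => by
        have hfX : DiffAt (f • X) p := hf.smul_section hX
        rw [inner_nabla hfX hY hZ, koszul_smul hf hX hY hZ, ← inner_nabla hX hY hZ]
        simp [inner_add_left, inner_smul_left]
        ring }

/-- `leviCivita` is torsion free: `∇_Y X - ∇_X Y = [Y, X]`. -/
theorem leviCivita_torsion {X Y : Π x : M, TangentSpace (𝓡 n) x} {p : M} (hX : DiffAt X p)
    (hY : DiffAt Y p) :
    leviCivita n M X p (Y p) - leviCivita n M Y p (X p) = mlieBracket (𝓡 n) Y X p := by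
  refine ext_inner_right ℝ fun w => ?_
  have hZ : DiffAt (extend (EuclideanSpace ℝ (Fin n)) w) p :=
    mdifferentiableAt_extend (I := 𝓡 n) ..
  have h1 := inner_nabla hX hY hZ
  have h2 := inner_nabla hY hX hZ
  have e : metricFun Y X = metricFun X Y := by
    ext x; simp [metricFun, real_inner_comm]
  have e2 : mlieBracket (𝓡 n) X Y p = - mlieBracket (𝓡 n) Y X p := mlieBracket_swap_apply
  simp only [koszul, e, e2, extend_apply_self, inner_neg_left] at h1 h2
  change inner ℝ (nabla X p (Y p) - nabla Y p (X p)) w = _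
  rw [inner_sub_left]
  linarith

/-- `leviCivita` is compatible with the metric: `Y g(X, Z) = g(∇_Y X, Z) + g(X, ∇_Y Z)`. -/
theorem leviCivita_metric {X Y Z : Π x : M, TangentSpace (𝓡 n) x} {p : M} (hX : DiffAt X p)
    (hY : DiffAt Y p) (hZ : DiffAt Z p) :
    mvfderiv (𝓡 n) (metricFun X Z) p (Y p)
      = inner ℝ (leviCivita n M X p (Y p)) (Z p) + inner ℝ (X p) (leviCivita n M Z p (Y p)) := by
  have h1 := inner_nabla hX hY hZ
  have h2 := inner_nabla hZ hY hX
  have e (A B : Π x : M, TangentSpace (𝓡 n) x) : metricFun A B = metricFun B A := by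
    ext x; simp [metricFun, real_inner_comm]
  have e2 : mlieBracket (𝓡 n) Z X p = - mlieBracket (𝓡 n) X Z p := mlieBracket_swap_apply
  simp only [koszul, e Z X, e Y X, e2, inner_neg_left] at h1 h2
  change _ = inner ℝ (nabla X p (Y p)) (Z p) + inner ℝ (X p) (nabla Z p (Y p))
  rw [real_inner_comm _ (X p)]
  linarith

variable (n) in
/-- The curvature tensor `R(u, v)w = ∇_U ∇_V W - ∇_V ∇_U W - ∇_[U, V] W` at `p`, where `U, V, W`
are vector fields, smooth near `p`, that extend `u, v, w`. -/
def riemann (p : M) (u v w : TangentSpace (𝓡 n) p) : TangentSpace (𝓡 n) p :=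
  let U : Π x : M, TangentSpace (𝓡 n) x := extend (EuclideanSpace ℝ (Fin n)) u
  let V : Π x : M, TangentSpace (𝓡 n) x := extend (EuclideanSpace ℝ (Fin n)) v
  let W : Π x : M, TangentSpace (𝓡 n) x := extend (EuclideanSpace ℝ (Fin n)) w
  leviCivita n M (fun x => leviCivita n M W x (V x)) p u
    - leviCivita n M (fun x => leviCivita n M W x (U x)) p v
    - leviCivita n M W p (mlieBracket (𝓡 n) U V p)

variable (n) in
/-- An orthonormal basis of `T_p M`. -/
def frame (p : M) : OrthonormalBasis (Fin n) ℝ (TangentSpace (𝓡 n) p) :=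
  haveI : FiniteDimensional ℝ (TangentSpace (𝓡 n) p) :=
    inferInstanceAs (FiniteDimensional ℝ (EuclideanSpace ℝ (Fin n)))
  (stdOrthonormalBasis ℝ (TangentSpace (𝓡 n) p)).reindex
    (finCongr (finrank_euclideanSpace_fin (𝕜 := ℝ) (n := n)))

variable (n) in
/-- The Ricci tensor `Ric(v, w) = tr (u ↦ R(u, v)w)`, as the sum `∑ i, g(R(e_i, v)w, e_i)` over an
orthonormal basis. -/
def ricci (p : M) (v w : TangentSpace (𝓡 n) p) : ℝ :=
  ∑ i, inner ℝ (riemann n p (frame n p i) v w) (frame n p i)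

variable (n) in
/-- The scalar curvature, the metric trace of the Ricci tensor. -/
def scalarCurvature (p : M) : ℝ := ∑ i : Fin n, ricci n p (frame n p i) (frame n p i)

/-- The Lie derivative of the metric along `X`,
`(L_X g)(Y, Z) = X g(Y, Z) - g([X, Y], Z) - g(Y, [X, Z])`, at `p`, where `Y, Z` are vector fields,
smooth near `p`, that extend the tangent vectors `v, w`. -/
def lieMetric (X : Π x : M, TangentSpace (𝓡 n) x) (p : M) (v w : TangentSpace (𝓡 n) p) : ℝ :=
  let Y : Π x : M, TangentSpace (𝓡 n) x := extend (EuclideanSpace ℝ (Fin n)) v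
  let Z : Π x : M, TangentSpace (𝓡 n) x := extend (EuclideanSpace ℝ (Fin n)) w
  mvfderiv (𝓡 n) (metricFun Y Z) p (X p) - inner ℝ (mlieBracket (𝓡 n) X Y p) w
    - inner ℝ v (mlieBracket (𝓡 n) X Z p)

/-- Smooth vector fields on `M`. -/
def IsSmoothField (X : Π x : M, TangentSpace (𝓡 n) x) : Prop :=
  ContMDiff (𝓡 n) (𝓡 n).tangent ∞
    (fun x => TotalSpace.mk' (EuclideanSpace ℝ (Fin n)) x (X x))

/-- `(M, g)` with the smooth potential field `X` and the constants `α, β, lam` is a Ricci-Yamabe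
soliton: `α Ric + (1/2) L_X g + (lam - (β/2) R) g = 0`. -/
structure IsRicciYamabeSoliton (X : Π x : M, TangentSpace (𝓡 n) x) (α β lam : ℝ) : Prop where
  smooth : IsSmoothField X
  equation : ∀ (p : M) (v w : TangentSpace (𝓡 n) p),
    α * ricci n p v w + 1 / 2 * lieMetric X p v w
      + (lam - β / 2 * scalarCurvature n p) * inner ℝ v w = 0

/-- The soliton is expanding. -/
def IsExpandingSoliton (X : Π x : M, TangentSpace (𝓡 n) x) (α β lam : ℝ) : Prop :=
  IsRicciYamabeSoliton X α β lam ∧ 0 < lam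

/-- The soliton is steady. -/
def IsSteadySoliton (X : Π x : M, TangentSpace (𝓡 n) x) (α β lam : ℝ) : Prop :=
  IsRicciYamabeSoliton X α β lam ∧ lam = 0

/-- The soliton is shrinking. -/
def IsShrinkingSoliton (X : Π x : M, TangentSpace (𝓡 n) x) (α β lam : ℝ) : Prop :=
  IsRicciYamabeSoliton X α β lam ∧ lam < 0

/-- `X` is concircular with the smooth function `φ`: `∇_v X = φ v` for all tangent vectors `v`. -/
structure IsConcircular (X : Π x : M, TangentSpace (𝓡 n) x) (φ : M → ℝ) : Prop where
  smooth : ContMDiff (𝓡 n) 𝓘(ℝ, ℝ) ∞ φ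
  nabla_eq : ∀ (p : M) (v : TangentSpace (𝓡 n) p), leviCivita n M X p v = φ p • v

end Smooth

end RicciYamabe

end

namespace RicciYamabe

variable {n : ℕ} {M : Type*} [TopologicalSpace M] [ChartedSpace (EuclideanSpace ℝ (Fin n)) M]
  [IsManifold (𝓡 n) ∞ M]

/-! Since the Levi-Civita connection is metric and torsion free, `L_X g` is twice the symmetric part
of `∇X` (`lieMetric_eq_inner_leviCivita`). For a concircular field `∇X = φ · id`, so `(1/2) L_X g =
φ g` (`IsConcircular.lieMetric_eq`), and the soliton equation becomes `α Ric + (φ + lam - (β/2) R) g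
= 0`. Its metric trace is the scalar identity `α R + n (φ + lam - (β/2) R) = 0`
(`IsRicciYamabeSoliton.trace_eq`), because `tr Ric = R` and `tr g = n`. Solving for the constant
gives `lam = (nβ - 2α)/(2n) · R - φ` at every point, so the sign of `lam` is decided by comparing `φ
p` with `(nβ - 2α)/(2n) · R p` at any single `p`. -/

theorem IsSmoothField.diffAt {X : Π x : M, TangentSpace (𝓡 n) x} (hX : IsSmoothField X) (p : M) :
    DiffAt X p :=
  (hX p).mdifferentiableAt (by simp)

variable [RiemannianBundle (fun x : M => TangentSpace (𝓡 n) x)]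
  [IsContMDiffRiemannianBundle (𝓡 n) ∞ (EuclideanSpace ℝ (Fin n))
    (fun x : M => TangentSpace (𝓡 n) x)]

/-- `(L_X g)(v, w) = g(∇_v X, w) + g(v, ∇_w X)`. -/
theorem lieMetric_eq_inner_leviCivita {X : Π x : M, TangentSpace (𝓡 n) x} {p : M}
    (hX : DiffAt X p) (v w : TangentSpace (𝓡 n) p) :
    lieMetric X p v w
      = inner ℝ (leviCivita n M X p v) w + inner ℝ v (leviCivita n M X p w) := by
  have hY : DiffAt (extend (EuclideanSpace ℝ (Fin n)) v) p :=
    mdifferentiableAt_extend (I := 𝓡 n) ..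
  have hZ : DiffAt (extend (EuclideanSpace ℝ (Fin n)) w) p :=
    mdifferentiableAt_extend (I := 𝓡 n) ..
  -- With `Y, Z` the extensions of `v, w`, differentiate `g(Y, Z)` along `X`. Torsion-freeness
  -- writes `[X, Y] = ∇_X Y - ∇_Y X`, and likewise for `Z`, so the `∇_X` terms cancel and only `∇_v
  -- X` and `∇_w X` remain.
  have h := leviCivita_metric hY hX hZ
  have hXY := leviCivita_torsion hY hX
  have hXZ := leviCivita_torsion hZ hX
  simp only [extend_apply_self] at h hXY hXZ
  simp only [lieMetric]
  rw [h, ← hXY, ← hXZ, inner_sub_left, inner_sub_right]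
  ring

/-- A concircular field is conformal: `L_X g = 2 φ g`. -/
theorem IsConcircular.lieMetric_eq {X : Π x : M, TangentSpace (𝓡 n) x} {φ : M → ℝ} {p : M}
    (h : IsConcircular X φ) (hX : DiffAt X p) (v w : TangentSpace (𝓡 n) p) :
    lieMetric X p v w = 2 * φ p * inner ℝ v w := by
  rw [lieMetric_eq_inner_leviCivita hX, h.nabla_eq, h.nabla_eq, real_inner_smul_left,
    real_inner_smul_right]
  ring

/-- The metric trace of the Ricci-Yamabe soliton equation with a concircular potential field. -/
theorem IsRicciYamabeSoliton.trace_eq {X : Π x : M, TangentSpace (𝓡 n) x} {φ : M → ℝ}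
    {α β lam : ℝ} (hsol : IsRicciYamabeSoliton X α β lam) (hX : IsConcircular X φ) (p : M) :
    α * scalarCurvature n p + n * (φ p + (lam - β / 2 * scalarCurvature n p)) = 0 := by
  -- The diagonal entries of the soliton equation in an orthonormal frame: `g(e_i, e_i) = 1`, and
  -- half the Lie derivative contributes `φ p`. Summing over `i` produces `R` and the factor `n`.
  have key (i : Fin n) : α * ricci n p (frame n p i) (frame n p i)
      + (φ p + (lam - β / 2 * scalarCurvature n p)) = 0 := by
    have h := hsol.equation p (frame n p i) (frame n p i)
    rw [hX.lieMetric_eq (hsol.smooth.diffAt p), (frame n p).inner_eq_one] at h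
    linarith
  have h := Finset.sum_eq_zero fun i (_ : i ∈ Finset.univ) => key i
  rwa [Finset.sum_add_distrib, ← Finset.mul_sum, Finset.sum_const, Finset.card_univ,
    Fintype.card_fin, nsmul_eq_mul] at h

end RicciYamabe

theorem mainTheorem9 {n : ℕ} (hn : 3 ≤ n) {M : Type*} [TopologicalSpace M]
    [ChartedSpace (EuclideanSpace ℝ (Fin n)) M] [IsManifold (𝓡 n) ∞ M]
    [RiemannianBundle (fun x : M => TangentSpace (𝓡 n) x)]
    [IsContMDiffRiemannianBundle (𝓡 n) ∞ (EuclideanSpace ℝ (Fin n))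
      (fun x : M => TangentSpace (𝓡 n) x)]
    (X : Π x : M, TangentSpace (𝓡 n) x) (φ : M → ℝ) (α β lam : ℝ) (hα : α ≠ 0)
    (hsol : RicciYamabe.IsRicciYamabeSoliton X α β lam)
    (hX : RicciYamabe.IsConcircular X φ) (p : M) :
    (RicciYamabe.IsExpandingSoliton X α β lam ↔
      φ p < (n * β - 2 * α) / (2 * n) * RicciYamabe.scalarCurvature n p) ∧
    (RicciYamabe.IsSteadySoliton X α β lam ↔
      φ p = (n * β - 2 * α) / (2 * n) * RicciYamabe.scalarCurvature n p) ∧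
    (RicciYamabe.IsShrinkingSoliton X α β lam ↔
      φ p > (n * β - 2 * α) / (2 * n) * RicciYamabe.scalarCurvature n p) := by
  have hn0 : (n : ℝ) ≠ 0 := Nat.cast_ne_zero.mpr (by omega)
  have h := hsol.trace_eq hX p
  -- The trace identity divided by `n` and solved for `lam`.
  have hlam : lam = (n * β - 2 * α) / (2 * n) * RicciYamabe.scalarCurvature n p - φ p := by
    field_simp
    linarith
  -- Each type of soliton is the soliton equation together with a sign condition on `lam`. The
  -- equation is `hsol`, so only the sign is at stake, and `hlam` translates it in both directions.
  refine ⟨⟨fun h => ?_, fun h => ⟨hsol, ?_⟩⟩, ⟨fun h => ?_, fun h => ⟨hsol, ?_⟩⟩,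
    ⟨fun h => ?_, fun h => ⟨hsol, ?_⟩⟩⟩
  · linarith [h.2]
  · linarith
  · linarith [h.2]
  · linarith
  · linarith [h.2]
  · linarith
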